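/- Let $m\ge 1$ and let $\mathbf{y}=\mathbf{G}(x,\mathbf{y})$, with $\mathbf{y}=(y_1,\ldots,y_m)$ and $\mathbf{G}=(G_1,\ldots,G_m)$, be a system of equations whose right-hand sides $G_i(x,\mathbf{y})$ are formal power series with real coefficients. Write $J_{\mathbf G}=(\partial G_i/\partial y_j)$ for the matrix of formal partial derivatives. The system is called \emph{well-conditioned} if: (a) each $G_i$ has nonnegative coefficients; (b) $\mathbf{G}$ is holomorphic in a neighborhood of the origin; (c) $\mathbf{G}(0,\mathbf{y})=\mathbf{0}$; (d) $G_i(x,\mathbf{0})\neq 0$ for all $i$; (e) $\det(I-J_{\mathbf G}(0,\mathbf{0}))\neq 0$; (f) $J_{\mathbf G}$ is irreducible, that is, the directed graph on $\{1,\ldots,m\}$ with an edge from $i$ to $j$ whenever $\partial G_i/\partial y_j\neq 0$ is strongly connected; (g) $\partial^2 G_i/\partial y_j\partial y_k\neq 0$ for some $i,j,k$. A well-conditioned system has a \emph{standard solution}, namely the unique vector $\mathbf{T}(x)=(T_1(x),\ldots,T_m(x))$ of formal power series with nonnegative coefficients and zero constant terms such that $\mathbf{T}(x)=\mathbf{G}(x,\mathbf{T}(x))$.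 All $T_i$ have the same radius of convergence $\rho\in(0,\infty)$ and converge at $\rho$; the point $(\rho,\boldsymbol{\tau})$ with $\tau_i=T_i(\rho)$ is the \emph{extreme point} of the system. A \emph{characteristic point} is a point $(a,\mathbf{b})\in\mathbb{R}^{m+1}$ with $a,b_1,\ldots,b_m>0$ such that all the series $G_i$ and $\partial G_i/\partial y_j$ converge at $(a,\mathbf{b})$, $b_i=G_i(a,\mathbf{b})$ for all $i$, and $\det(I-J_{\mathbf G}(a,\mathbf{b}))=0$. Let $\mathcal{CP}$ be the set of characteristic points. **Proposition.** Suppose the extreme point $(\rho,\boldsymbol{\tau})$ of a well-conditioned system $\mathbf{y}=\mathbf{G}(x,\mathbf{y})$ is a characteristic point of the system. Then: (a) $\rho$ is the largest first coordinate of any characteristic point, that is, $\rho=\max\{a:(a,\mathbf{b})\in\mathcal{CP}\}$; (b) $(\rho,\boldsymbol{\tau})$ is the only characteristic point whose first coordinate is $\rho$. -/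

import Mathlib

open scoped Topology ENNReal

noncomputable section

namespace CharSystem

/-- The `n`-th term (coefficient times monomial) of the real power series `A`, evaluated at the
real point `c`. -/
def summand {σ : Type*} (A : MvPowerSeries σ ℝ) (c : σ → ℝ) (n : σ →₀ ℕ) : ℝ :=
  MvPowerSeries.coeff n A * n.prod fun k e => c k ^ e

/-- The same term, evaluated at the complex point `z`. -/
def summandC {σ : Type*} (A : MvPowerSeries σ ℝ) (z : σ → ℂ) (n : σ →₀ ℕ) : ℂ :=
  ((MvPowerSeries.coeff n A : ℝ) : ℂ) * n.prod fun k e => z k ^ e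

/-- `A(c) = v`: the power series `A` converges at the point `c`, with the finite value `v`. -/
def HasValue {σ : Type*} (A : MvPowerSeries σ ℝ) (c : σ → ℝ) (v : ℝ) : Prop :=
  HasSum (summand A c) v

/-- The formal power series obtained from `A` by setting the variables in `s` equal to zero. -/
def setZero {σ : Type*} (s : Set σ) (A : MvPowerSeries σ ℝ) : MvPowerSeries σ ℝ :=
  Set.indicator {n : σ →₀ ℕ | ∀ k ∈ s, n k = 0} fun n => MvPowerSeries.coeff n A

/-- A system `y = G(x, y)` of `m` equations. The variables of each `G i` are indexed by
`Fin (m + 1)`: index `0` is `x`, and index `j.succ` is `y_j`. -/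
abbrev System (m : ℕ) := Fin m → MvPowerSeries (Fin (m + 1)) ℝ

/-- The Jacobian matrix `(∂G_i/∂y_j)` of formal power series. -/
def jacobian {m : ℕ} (G : System m) :
    Matrix (Fin m) (Fin m) (MvPowerSeries (Fin (m + 1)) ℝ) :=
  Matrix.of fun i j => MvPowerSeries.pderiv ℝ j.succ (G i)

/-- A square matrix is irreducible if the directed graph with an edge `i → j` for every
nonzero entry `M i j` is strongly connected. -/
def IrreducibleMatrix {ι R : Type*} [Zero R] (M : Matrix ι ι R) : Prop :=
  ∀ i j, Relation.ReflTransGen (fun k l => M k l ≠ 0) i j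

/-- Well-conditioned systems. -/
structure WellConditioned {m : ℕ} (G : System m) : Prop where
  /-- The coefficients are nonnegative. -/
  nonneg : ∀ i n, 0 ≤ MvPowerSeries.coeff n (G i)
  /-- `G` is holomorphic in a neighborhood of the origin. -/
  holomorphic : ∃ U : Set (Fin (m + 1) → ℂ), IsOpen U ∧ 0 ∈ U ∧ ∀ i,
    (∀ z ∈ U, Summable (summandC (G i) z)) ∧
    DifferentiableOn ℂ (fun z => ∑' n, summandC (G i) z n) U
  /-- `G(0, y) = 0`. -/
  x_zero : ∀ i, setZero {0} (G i) = 0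
  /-- `G_i(x, 0) ≠ 0` for all `i`. -/
  y_zero : ∀ i, setZero (Set.range Fin.succ) (G i) ≠ 0
  /-- `det (I - J_G(0, 0)) ≠ 0`. -/
  det_ne_zero : (1 - (jacobian G).map MvPowerSeries.constantCoeff).det ≠ 0
  /-- The Jacobian matrix is irreducible. -/
  irreducible : IrreducibleMatrix (jacobian G)
  /-- The system is nonlinear in `y`. -/
  nonlinear : ∃ i j k : Fin m,
    MvPowerSeries.pderiv ℝ j.succ (MvPowerSeries.pderiv ℝ k.succ (G i)) ≠ 0

/-- `T` is the standard solution of the system: a vector of formal power series in `x` with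
nonnegative coefficients (and constant term zero, so that the composition makes sense) that
satisfies `T(x) = G(x, T(x))` formally. -/
structure IsStandardSolution {m : ℕ} (G : System m) (T : Fin m → PowerSeries ℝ) : Prop where
  nonneg : ∀ i n, 0 ≤ PowerSeries.coeff n (T i)
  constantCoeff : ∀ i, PowerSeries.constantCoeff (T i) = 0
  eq_subst : ∀ i, T i =
    MvPowerSeries.subst (Fin.cons PowerSeries.X T : Fin (m + 1) → PowerSeries ℝ) (G i)

/-- The radius of convergence of a power series in one variable. -/
def radius (A : PowerSeries ℝ) : ℝ≥0∞ :=
  (FormalMultilinearSeries.ofScalars ℝ fun n => PowerSeries.coeff n A).radius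

/-- `(ρ, τ)` is the extreme point of the system: `ρ` is the (common) radius of convergence of the
components `T_i` of the standard solution, and `τ_i = T_i(ρ)`. -/
def IsExtremePoint {m : ℕ} (G : System m) (ρ : ℝ) (τ : Fin m → ℝ) : Prop :=
  0 ≤ ρ ∧ ∃ T : Fin m → PowerSeries ℝ, IsStandardSolution G T ∧
    ∀ i, radius (T i) = ENNReal.ofReal ρ ∧
      HasSum (fun n => PowerSeries.coeff n (T i) * ρ ^ n) (τ i)

/-- `(a, b)` is a characteristic point of the system: a positive solution of `y = G(x, y)`,
`det (I - J_G(x, y)) = 0`, where `J_G(a, b)` is the (finite) value of the formal Jacobian. -/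
def IsCharacteristicPoint {m : ℕ} (G : System m) (a : ℝ) (b : Fin m → ℝ) : Prop :=
  0 < a ∧ (∀ i, 0 < b i) ∧
    (∀ i, HasValue (G i) (Fin.cons a b : Fin (m + 1) → ℝ) (b i)) ∧
    ∃ J : Matrix (Fin m) (Fin m) ℝ,
      (∀ i j, HasValue (jacobian G i j) (Fin.cons a b : Fin (m + 1) → ℝ) (J i j)) ∧
      (1 - J).det = 0

end CharSystem

end

/-!
If `(a, b)` is a nonnegative solution of `y = G(x, y)`, then every partial sum of the standard
solution `T` at `a` is at most `b`: as `G(0, y) = 0`, the terms of `T = G(x, T)` of degree at most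
`N` depend only on the terms of `T` of degree less than `N`, so this follows by induction on `N`.
Hence `a ≤ ρ`, and `τ ≤ b` when `a = ρ`.

In the latter case, convexity of `G` gives `J (b - τ) ≤ b - τ` for the Jacobian matrix `J` at the
characteristic point `(ρ, τ)`. As `J` is irreducible with eigenvalue `1`, Perron–Frobenius theory
forces `b = τ`, or else `b > τ` in every coordinate and `J (b - τ) = b - τ`. The second alternative
says that `G` agrees with its linearization at `b`, which contradicts nonlinearity.
-/

namespace CharSystem

section TruncEval

open PowerSeries

lemma eval_trunc_eq_sum {R : Type*} [Semiring R] (a : R) (N : ℕ) (P : R⟦X⟧) :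
    (trunc N P).eval a = ∑ n ∈ Finset.range N, coeff n P * a ^ n := by
  rw [← Polynomial.eval₂_id, eval₂_trunc_eq_sum_range]
  simp only [RingHom.id_apply]

lemma trunc_succ_X_mul {R : Type*} [Semiring R] (N : ℕ) (P : R⟦X⟧) :
    trunc (N + 1) (X * P) = Polynomial.X * trunc N P := by
  ext n
  cases n <;> simp [coeff_trunc, coeff_succ_X_mul]

lemma coeff_trunc_nonneg {R : Type*} [Semiring R] [Preorder R] {P : R⟦X⟧}
    (hP : ∀ n, 0 ≤ coeff n P) (N n : ℕ) : 0 ≤ (trunc N P).coeff n := by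
  rw [coeff_trunc]
  split_ifs
  exacts [hP n, le_rfl]

variable {R : Type*} [CommSemiring R] [PartialOrder R] [IsOrderedRing R] {a v w : R} {N : ℕ}
  {P Q : R⟦X⟧}

lemma eval_trunc_nonneg (ha : 0 ≤ a) (hP : ∀ n, 0 ≤ coeff n P) (N : ℕ) :
    0 ≤ (trunc N P).eval a := by
  rw [eval_trunc_eq_sum]
  exact Finset.sum_nonneg fun n _ => mul_nonneg (hP n) (pow_nonneg ha n)

lemma eval_trunc_coe_le_eval (ha : 0 ≤ a) {p : Polynomial R} (hp : ∀ n, 0 ≤ p.coeff n) (N : ℕ) :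
    (trunc N (p : R⟦X⟧)).eval a ≤ p.eval a := by
  rw [eval_trunc_eq_sum, Polynomial.eval_eq_sum_range' (Nat.lt_succ_of_le (le_max_right N _))]
  simp only [Polynomial.coeff_coe]
  refine Finset.sum_le_sum_of_subset_of_nonneg (fun n hn => ?_)
    fun n _ _ => mul_nonneg (hp n) (pow_nonneg ha n)
  exact Finset.mem_range.2 (Nat.lt_succ_of_le ((Finset.mem_range.1 hn).le.trans (le_max_left N _)))

lemma coeff_mul_nonneg (hP : ∀ n, 0 ≤ coeff n P) (hQ : ∀ n, 0 ≤ coeff n Q) (n : ℕ) :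
    0 ≤ coeff n (P * Q) := by
  rw [coeff_mul]
  exact Finset.sum_nonneg fun p _ => mul_nonneg (hP _) (hQ _)

lemma eval_trunc_mul_le (ha : 0 ≤ a) (hP : ∀ n, 0 ≤ coeff n P) (hQ : ∀ n, 0 ≤ coeff n Q)
    (N : ℕ) : (trunc N (P * Q)).eval a ≤ (trunc N P).eval a * (trunc N Q).eval a := by
  rw [← trunc_trunc_mul_trunc, ← Polynomial.coe_mul, ← Polynomial.eval_mul]
  refine eval_trunc_coe_le_eval ha (fun n => ?_) N
  rw [← Polynomial.coeff_coe, Polynomial.coe_mul]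
  refine coeff_mul_nonneg (fun n => ?_) (fun n => ?_) n <;> rw [Polynomial.coeff_coe]
  exacts [coeff_trunc_nonneg hP N n, coeff_trunc_nonneg hQ N n]

/-- The coefficients of the power series `P` are nonnegative, and its terms of degree less than `N`
sum to at most `v` at `a`. The two conditions are bundled because the bound is multiplicative only
in the presence of nonnegativity. -/
structure TruncEvalLE {R : Type*} [Semiring R] [LE R] (a : R) (N : ℕ) (P : R⟦X⟧) (v : R) :
    Prop where
  coeff_nonneg : ∀ n, 0 ≤ coeff n P
  eval_trunc_le : (trunc N P).eval a ≤ v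

namespace TruncEvalLE

lemma nonneg (ha : 0 ≤ a) (hP : TruncEvalLE a N P v) : 0 ≤ v :=
  (eval_trunc_nonneg ha hP.coeff_nonneg N).trans hP.eval_trunc_le

lemma one (ha : 0 ≤ a) (N : ℕ) : TruncEvalLE a N 1 1 where
  coeff_nonneg n := by
    rw [coeff_one]
    split_ifs
    exacts [zero_le_one, le_rfl]
  eval_trunc_le := by
    simpa using eval_trunc_coe_le_eval ha (p := (1 : Polynomial R))
      (fun n => by rw [Polynomial.coeff_one]; split_ifs <;> simp) N

lemma X (ha : 0 ≤ a) (N : ℕ) : TruncEvalLE a N X a where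
  coeff_nonneg n := by
    rw [coeff_X]
    split_ifs
    exacts [zero_le_one, le_rfl]
  eval_trunc_le := by
    simpa using eval_trunc_coe_le_eval ha (p := (Polynomial.X : Polynomial R))
      (fun n => by rw [Polynomial.coeff_X]; split_ifs <;> simp) N

lemma mul (ha : 0 ≤ a) (hP : TruncEvalLE a N P v) (hQ : TruncEvalLE a N Q w) :
    TruncEvalLE a N (P * Q) (v * w) where
  coeff_nonneg := coeff_mul_nonneg hP.coeff_nonneg hQ.coeff_nonneg
  eval_trunc_le := (eval_trunc_mul_le ha hP.coeff_nonneg hQ.coeff_nonneg N).trans <|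
    mul_le_mul hP.eval_trunc_le hQ.eval_trunc_le (eval_trunc_nonneg ha hQ.coeff_nonneg N)
      (hP.nonneg ha)

lemma pow (ha : 0 ≤ a) (hP : TruncEvalLE a N P v) (e : ℕ) : TruncEvalLE a N (P ^ e) (v ^ e) := by
  induction e with
  | zero => simpa only [pow_zero] using one ha N
  | succ e ih => simpa only [pow_succ] using ih.mul ha hP

lemma X_mul (ha : 0 ≤ a) (hP : TruncEvalLE a N P v) :
    TruncEvalLE a (N + 1) (PowerSeries.X * P) (a * v) where
  coeff_nonneg := coeff_mul_nonneg (X ha N).coeff_nonneg hP.coeff_nonneg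
  eval_trunc_le := by
    rw [trunc_succ_X_mul, Polynomial.eval_mul, Polynomial.eval_X]
    exact mul_le_mul_of_nonneg_left hP.eval_trunc_le ha

variable {σ : Type*} {F : σ → R⟦X⟧} {f : σ → R}

lemma monomial (ha : 0 ≤ a) (hF : ∀ k, TruncEvalLE a N (F k) (f k)) (n : σ →₀ ℕ) :
    TruncEvalLE a N (n.prod fun k e => F k ^ e) (n.prod fun k e => f k ^ e) :=
  Finset.prod_hom_rel (one ha N) fun k _ _ h => ((hF k).pow ha (n k)).mul ha h

lemma monomial_succ (ha : 0 ≤ a) (hF : ∀ k, TruncEvalLE a N (F k) (f k)) {k₀ : σ}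
    (hF₀ : F k₀ = PowerSeries.X) (hf₀ : f k₀ = a) {n : σ →₀ ℕ} (hn : n k₀ ≠ 0) :
    TruncEvalLE a (N + 1) (n.prod fun k e => F k ^ e) (n.prod fun k e => f k ^ e) := by
  obtain ⟨n, rfl⟩ := le_iff_exists_add.1
    (Finsupp.single_le_iff.2 (Nat.one_le_iff_ne_zero.2 hn))
  classical
  rw [Finsupp.prod_add_index' (by simp) (by simp [pow_add]),
    Finsupp.prod_add_index' (by simp) (by simp [pow_add]), Finsupp.prod_single_index (by simp),
    Finsupp.prod_single_index (by simp), pow_one, pow_one, hF₀, hf₀]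
  exact (monomial ha hF n).X_mul ha

end TruncEvalLE

end TruncEval

section Series

variable {σ : Type*} {A : MvPowerSeries σ ℝ} {c : σ → ℝ} {v : ℝ}

lemma summand_nonneg (hA : ∀ n, 0 ≤ MvPowerSeries.coeff n A) (hc : ∀ k, 0 ≤ c k) (n : σ →₀ ℕ) :
    0 ≤ summand A c n :=
  mul_nonneg (hA n) (Finset.prod_nonneg fun k _ => pow_nonneg (hc k) _)

lemma HasValue.nonneg (hA : ∀ n, 0 ≤ MvPowerSeries.coeff n A) (hc : ∀ k, 0 ≤ c k)
    (hv : HasValue A c v) : 0 ≤ v :=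
  HasSum.nonneg (summand_nonneg hA hc) hv

lemma HasValue.pos (hA : ∀ n, 0 ≤ MvPowerSeries.coeff n A) (hA0 : A ≠ 0) (hc : ∀ k, 0 < c k)
    (hv : HasValue A c v) : 0 < v := by
  obtain ⟨n, hn⟩ := (MvPowerSeries.ne_zero_iff_exists_coeff_ne_zero A).1 hA0
  calc 0 < summand A c n :=
        mul_pos ((hA n).lt_of_ne' hn) (Finset.prod_pos fun k _ => pow_pos (hc k) _)
    _ ≤ v := le_hasSum hv n fun l _ => summand_nonneg hA (fun k => (hc k).le) l

lemma coeff_pderiv_nonneg (hA : ∀ n, 0 ≤ MvPowerSeries.coeff n A) (k : σ) (n : σ →₀ ℕ) :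
    0 ≤ MvPowerSeries.coeff n (MvPowerSeries.pderiv ℝ k A) := by
  rw [MvPowerSeries.coeff_pderiv]
  exact mul_nonneg (hA _) (by positivity)

lemma coeff_eq_zero_of_setZero_eq_zero {s : Set σ} (hA : setZero s A = 0) {n : σ →₀ ℕ}
    (hn : ∀ k ∈ s, n k = 0) : MvPowerSeries.coeff n A = 0 := by
  have h := congrFun hA n
  rwa [setZero, Set.indicator_of_mem (by exact hn)] at h

lemma TruncEvalLE.subst (hA : ∀ n, 0 ≤ MvPowerSeries.coeff n A) {F : σ → PowerSeries ℝ}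
    (hF : MvPowerSeries.HasSubst F) {a : ℝ} (ha : 0 ≤ a) {N : ℕ}
    (hmon : ∀ n, MvPowerSeries.coeff n A ≠ 0 →
      TruncEvalLE a N (n.prod fun k e => F k ^ e) (n.prod fun k e => c k ^ e))
    (hv : HasValue A c v) : TruncEvalLE a N (MvPowerSeries.subst F A) v := by
  set t : (σ →₀ ℕ) → ℕ → ℝ := fun n l =>
    MvPowerSeries.coeff n A * PowerSeries.coeff l (n.prod fun k e => F k ^ e) with ht
  have hfin : ∀ l, (fun n => t n l).HasFiniteSupport := fun l =>
    MvPowerSeries.coeff_subst_finite hF A (Finsupp.single () l)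
  have hcoeff : ∀ l, PowerSeries.coeff l (MvPowerSeries.subst F A) = ∑ᶠ n, t n l := fun l =>
    MvPowerSeries.coeff_subst hF A (Finsupp.single () l)
  have mul_nonneg_of_coeff {x : ℝ} (n : σ →₀ ℕ) (hx : MvPowerSeries.coeff n A ≠ 0 → 0 ≤ x) :
      0 ≤ MvPowerSeries.coeff n A * x := by
    by_cases h : MvPowerSeries.coeff n A = 0
    · simp [h]
    · exact mul_nonneg (hA n) (hx h)
  refine ⟨fun l => ?_, ?_⟩
  · rw [hcoeff]
    exact finsum_nonneg fun n => mul_nonneg_of_coeff n fun h => (hmon n h).coeff_nonneg l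
  classical
  let S := (Finset.range N).biUnion fun l => (hfin l).toFinset
  have hsum : ∀ l ∈ Finset.range N,
      PowerSeries.coeff l (MvPowerSeries.subst F A) = ∑ n ∈ S, t n l := fun l hl => by
    rw [hcoeff]
    refine finsum_eq_sum_of_support_subset _ fun n hn => ?_
    exact Finset.mem_biUnion.2 ⟨l, hl, (hfin l).mem_toFinset.2 hn⟩
  calc (PowerSeries.trunc N (MvPowerSeries.subst F A)).eval a
      = ∑ l ∈ Finset.range N, ∑ n ∈ S, t n l * a ^ l := by
        rw [eval_trunc_eq_sum]
        exact Finset.sum_congr rfl fun l hl => by rw [hsum l hl, Finset.sum_mul]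
    _ = ∑ n ∈ S, MvPowerSeries.coeff n A *
          (PowerSeries.trunc N (n.prod fun k e => F k ^ e)).eval a := by
        rw [Finset.sum_comm]
        simp only [eval_trunc_eq_sum, Finset.mul_sum, ht, mul_assoc]
    _ ≤ ∑ n ∈ S, summand A c n := Finset.sum_le_sum fun n _ => by
        rw [← sub_nonneg, summand, ← mul_sub]
        exact mul_nonneg_of_coeff n fun h => sub_nonneg.2 (hmon n h).eval_trunc_le
    _ ≤ v := sum_le_hasSum S (fun n _ => mul_nonneg_of_coeff n fun h => (hmon n h).nonneg ha) hv

lemma ofReal_le_radius {P : PowerSeries ℝ} {a C : ℝ} (ha : 0 ≤ a)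
    (hP : ∀ N, TruncEvalLE a N P C) : ENNReal.ofReal a ≤ radius P := by
  refine FormalMultilinearSeries.le_radius_of_bound _ C fun n => ?_
  have hcoeff := (hP 0).coeff_nonneg
  rw [FormalMultilinearSeries.ofScalars_norm, Real.coe_toNNReal a ha,
    Real.norm_of_nonneg (hcoeff n)]
  calc PowerSeries.coeff n P * a ^ n
      ≤ ∑ l ∈ Finset.range (n + 1), PowerSeries.coeff l P * a ^ l :=
        Finset.single_le_sum (f := fun l => PowerSeries.coeff l P * a ^ l)
          (fun l _ => mul_nonneg (hcoeff l) (pow_nonneg ha l)) (Finset.self_mem_range_succ n)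
    _ ≤ C := eval_trunc_eq_sum a (n + 1) P ▸ (hP (n + 1)).eval_trunc_le

end Series

section Tangent

open MvPolynomial

variable {σ R : Type*} [Fintype σ] [CommRing R] {c d : σ → R} {p q : MvPolynomial σ R}

/-- The first-order Taylor polynomial of `p` at the point `c`, evaluated at the point `d`. -/
noncomputable def linearization (p : MvPolynomial σ R) (c d : σ → R) : R :=
  eval c p + ∑ k, eval c (pderiv k p) * (d k - c k)

lemma linearization_C (r : R) : linearization (C r) c d = r := by
  simp [linearization]

lemma linearization_X (k : σ) : linearization (X k) c d = d k := by
  classical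
  simp [linearization, pderiv_X, Pi.single_apply, apply_ite (eval c)]

lemma linearization_mul (p q : MvPolynomial σ R) : linearization (p * q) c d =
    linearization p c d * linearization q c d -
      (linearization p c d - eval c p) * (linearization q c d - eval c q) := by
  have hderiv : ∑ k, eval c (pderiv k (p * q)) * (d k - c k) =
      (∑ k, eval c (pderiv k p) * (d k - c k)) * eval c q +
        eval c p * ∑ k, eval c (pderiv k q) * (d k - c k) := by
    rw [Finset.sum_mul, Finset.mul_sum, ← Finset.sum_add_distrib]
    refine Finset.sum_congr rfl fun k _ => ?_
    rw [pderiv_mul, map_add, map_mul, map_mul]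
    ring
  rw [linearization, hderiv, map_mul, linearization, linearization]
  ring

variable [LinearOrder R] [IsStrictOrderedRing R]

lemma linearization_mul_le (hp : eval c p ≤ linearization p c d)
    (hq : eval c q ≤ linearization q c d) :
    linearization (p * q) c d ≤ linearization p c d * linearization q c d := by
  rw [linearization_mul]
  exact sub_le_self _ (mul_nonneg (sub_nonneg.2 hp) (sub_nonneg.2 hq))

/-- The polynomials `p` with `0 ≤ p(c)` whose linearization at `c` takes at `d` a value between
`p(c)` and `p(d)`. The lower bounds are there to make the upper bound, which is the aim,
multiplicative. -/
noncomputable def tangentSubmonoid (c d : σ → R) : Submonoid (MvPolynomial σ R) where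
  carrier := {p | 0 ≤ eval c p ∧ eval c p ≤ linearization p c d ∧ linearization p c d ≤ eval d p}
  one_mem' := by simp [linearization]
  mul_mem' := by
    rintro p q ⟨hp₀, hp₁, hp₂⟩ ⟨hq₀, hq₁, hq₂⟩
    have hpq := mul_nonneg hp₀ (sub_nonneg.2 hq₁)
    have hqp := mul_nonneg hq₀ (sub_nonneg.2 hp₁)
    refine ⟨by simpa using mul_nonneg hp₀ hq₀, ?_, ?_⟩
    · rw [linearization_mul, map_mul]
      linarith
    · rw [map_mul]
      exact (linearization_mul_le hp₁ hq₁).trans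
        (mul_le_mul hp₂ hq₂ (hq₀.trans hq₁) (hp₀.trans (hp₁.trans hp₂)))

lemma monomial_mem_tangentSubmonoid (hc : ∀ k, 0 ≤ c k) (hcd : ∀ k, c k ≤ d k) (n : σ →₀ ℕ)
    {r : R} (hr : 0 ≤ r) : monomial n r ∈ tangentSubmonoid c d := by
  have hC : C r ∈ tangentSubmonoid c d := by
    refine ⟨?_, ?_, ?_⟩ <;> simp [linearization_C, hr]
  have hX : ∀ k, X k ∈ tangentSubmonoid c d := fun k => by
    refine ⟨?_, ?_, ?_⟩ <;> simp [linearization_X, hc, hcd]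
  rw [monomial_eq]
  exact mul_mem hC (prod_mem fun k _ => pow_mem (hX k) _)

lemma linearization_X_mul_X_lt {j k : σ} (hj : c j < d j) (hk : c k < d k) :
    linearization (X j * X k) c d < eval d (X j * X k) := by
  rw [linearization_mul, linearization_X, linearization_X, map_mul]
  simp only [eval_X]
  exact sub_lt_self _ (mul_pos (sub_pos.2 hj) (sub_pos.2 hk))

lemma linearization_monomial_lt (hc : ∀ l, 0 ≤ c l) (hcd : ∀ l, c l ≤ d l) (hd : ∀ l, 0 < d l)
    {j k : σ} (hj : c j < d j) (hk : c k < d k) (n : σ →₀ ℕ) {r : R} (hr : 0 < r) :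
    linearization (monomial (n + Finsupp.single j 1 + Finsupp.single k 1) r) c d <
      eval d (monomial (n + Finsupp.single j 1 + Finsupp.single k 1) r) := by
  have hfactor : monomial (n + Finsupp.single j 1 + Finsupp.single k 1) r =
      monomial n r * (X j * X k) := by
    simp only [X, monomial_mul, mul_one, add_assoc]
  obtain ⟨-, hn₁, hn₂⟩ := monomial_mem_tangentSubmonoid hc hcd n hr.le
  have hX : ∀ l, X l ∈ tangentSubmonoid c d := fun l =>
    monomial_mem_tangentSubmonoid hc hcd _ zero_le_one
  obtain ⟨hjk₀, hjk₁, -⟩ := mul_mem (hX j) (hX k)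
  have hpos : 0 < eval d (monomial n r) := by
    rw [eval_monomial]
    exact mul_pos hr (Finset.prod_pos fun l _ => pow_pos (hd l) _)
  rw [hfactor, map_mul]
  calc linearization (monomial n r * (X j * X k)) c d
      ≤ linearization (monomial n r) c d * linearization (X j * X k) c d :=
        linearization_mul_le hn₁ hjk₁
    _ ≤ eval d (monomial n r) * linearization (X j * X k) c d :=
        mul_le_mul_of_nonneg_right hn₂ (hjk₀.trans hjk₁)
    _ < eval d (monomial n r) * eval d (X j * X k) :=
        mul_lt_mul_of_pos_left (linearization_X_mul_X_lt hj hk) hpos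

end Tangent

section Convexity

variable {σ : Type*} {A : MvPowerSeries σ ℝ} {c d D : σ → ℝ} {u v : ℝ}

lemma summand_eq_eval_monomial (A : MvPowerSeries σ ℝ) (c : σ → ℝ) (n : σ →₀ ℕ) :
    summand A c n = MvPolynomial.eval c (MvPolynomial.monomial n (MvPowerSeries.coeff n A)) :=
  MvPolynomial.eval_monomial.symm

lemma HasValue.hasSum_eval_pderiv {k : σ} (h : HasValue (MvPowerSeries.pderiv ℝ k A) c v) :
    HasSum (fun n => MvPolynomial.eval c (MvPolynomial.pderiv k
      (MvPolynomial.monomial n (MvPowerSeries.coeff n A)))) v := by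
  refine ((add_left_injective (Finsupp.single k 1)).hasSum_iff fun n hn => ?_).1 ?_
  · have hnk : n k = 0 := by
      contrapose! hn
      exact ⟨n - Finsupp.single k 1, tsub_add_cancel_of_le
        (Finsupp.single_le_iff.2 (Nat.one_le_iff_ne_zero.2 hn))⟩
    simp [MvPolynomial.pderiv_monomial, hnk]
  · refine h.congr_fun fun n => ?_
    simp [summand, MvPowerSeries.coeff_pderiv, MvPolynomial.pderiv_monomial,
      MvPolynomial.eval_monomial]

variable [Fintype σ]

lemma HasValue.hasSum_linearization (hv : HasValue A c v)
    (hD : ∀ k, c k ≠ d k → HasValue (MvPowerSeries.pderiv ℝ k A) c (D k)) :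
    HasSum (fun n => linearization (MvPolynomial.monomial n (MvPowerSeries.coeff n A)) c d)
      (v + ∑ k, D k * (d k - c k)) := by
  have hv' : HasSum (fun n => MvPolynomial.eval c
      (MvPolynomial.monomial n (MvPowerSeries.coeff n A))) v :=
    hv.congr_fun fun n => (summand_eq_eval_monomial A c n).symm
  refine hv'.add (hasSum_sum fun k _ => ?_)
  obtain hk | hk := eq_or_ne (c k) (d k)
  · simpa only [hk, sub_self, mul_zero] using hasSum_zero
  · exact (hD k hk).hasSum_eval_pderiv.mul_right _

lemma HasValue.add_sum_pderiv_le (hA : ∀ n, 0 ≤ MvPowerSeries.coeff n A) (hc : ∀ k, 0 ≤ c k)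
    (hcd : ∀ k, c k ≤ d k) (hv : HasValue A c v)
    (hD : ∀ k, c k ≠ d k → HasValue (MvPowerSeries.pderiv ℝ k A) c (D k))
    (hu : HasValue A d u) : v + ∑ k, D k * (d k - c k) ≤ u := by
  refine hasSum_le (fun n => ?_) (hv.hasSum_linearization hD) hu
  rw [summand_eq_eval_monomial]
  exact (monomial_mem_tangentSubmonoid hc hcd n (hA n)).2.2

lemma HasValue.add_sum_pderiv_lt (hA : ∀ n, 0 ≤ MvPowerSeries.coeff n A) (hc : ∀ k, 0 ≤ c k)
    (hcd : ∀ k, c k ≤ d k) (hd : ∀ k, 0 < d k) (hv : HasValue A c v)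
    (hD : ∀ k, c k ≠ d k → HasValue (MvPowerSeries.pderiv ℝ k A) c (D k))
    (hu : HasValue A d u) {j k : σ} (hj : c j < d j) (hk : c k < d k)
    (hjk : MvPowerSeries.pderiv ℝ j (MvPowerSeries.pderiv ℝ k A) ≠ 0) :
    v + ∑ k, D k * (d k - c k) < u := by
  obtain ⟨n, hn⟩ := (MvPowerSeries.ne_zero_iff_exists_coeff_ne_zero _).1 hjk
  rw [MvPowerSeries.coeff_pderiv, MvPowerSeries.coeff_pderiv] at hn
  have hpos := (hA _).lt_of_ne' (left_ne_zero_of_mul (left_ne_zero_of_mul hn))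
  refine hasSum_lt (i := n + Finsupp.single j 1 + Finsupp.single k 1) (fun n => ?_) ?_
    (hv.hasSum_linearization hD) hu
  · rw [summand_eq_eval_monomial]
    exact (monomial_mem_tangentSubmonoid hc hcd n (hA n)).2.2
  · rw [summand_eq_eval_monomial]
    exact linearization_monomial_lt hc hcd hd hj hk n hpos

end Convexity

section PerronFrobenius

open Matrix

variable {ι R : Type*}

lemma IrreducibleMatrix.transpose [Zero R] {M : Matrix ι ι R} (hM : IrreducibleMatrix M) :
    IrreducibleMatrix Mᵀ :=
  fun i j => Relation.ReflTransGen.swap _ _ (hM j i)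

variable [Fintype ι] [CommRing R] [LinearOrder R] [IsStrictOrderedRing R]

lemma eq_of_le_of_dotProduct_eq {u v w : ι → R} (hw : ∀ i, 0 < w i) (huv : u ≤ v)
    (h : w ⬝ᵥ u = w ⬝ᵥ v) : u = v := by
  have hterm := (Finset.sum_eq_sum_iff_of_le
    fun i _ => mul_le_mul_of_nonneg_left (huv i) (hw i).le).1 h
  exact funext fun i => mul_left_cancel₀ (hw i).ne' (hterm i (Finset.mem_univ i))

variable {M : Matrix ι ι R} {u v : ι → R}

lemma IrreducibleMatrix.pos_of_mulVec_le (hirr : IrreducibleMatrix M) (hM : ∀ i j, 0 ≤ M i j)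
    (hv : 0 ≤ v) (hv0 : v ≠ 0) (hle : M *ᵥ v ≤ v) (i : ι) : 0 < v i := by
  obtain ⟨j, hj⟩ := Function.ne_iff.1 hv0
  have pos_of_edge : ∀ k l, M k l ≠ 0 → 0 < v l → 0 < v k := fun k l hkl hl =>
    calc 0 < M k l * v l := mul_pos ((hM k l).lt_of_ne' hkl) hl
      _ ≤ (M *ᵥ v) k := Finset.single_le_sum (f := fun l => M k l * v l)
          (fun l _ => mul_nonneg (hM k l) (hv l)) (Finset.mem_univ l)
      _ ≤ v k := hle k
  induction hirr i j using Relation.ReflTransGen.head_induction_on with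
  | refl => exact (hv j).lt_of_ne' hj
  | head hkl _ ih => exact pos_of_edge _ _ hkl ih

lemma vecMul_eq_of_le (hv : ∀ i, 0 < v i) (hMv : M *ᵥ v ≤ v) (hu : 0 ≤ u) (huM : u ≤ u ᵥ* M) :
    u ᵥ* M = u := by
  refine (eq_of_le_of_dotProduct_eq hv huM (le_antisymm ?_ ?_)).symm
  · exact dotProduct_le_dotProduct_of_nonneg_left huM fun i => (hv i).le
  · calc v ⬝ᵥ (u ᵥ* M) = u ⬝ᵥ (M *ᵥ v) := by rw [dotProduct_comm, dotProduct_mulVec]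
      _ ≤ u ⬝ᵥ v := dotProduct_le_dotProduct_of_nonneg_left hMv hu
      _ = v ⬝ᵥ u := dotProduct_comm _ _

lemma mulVec_eq_of_le (hu : ∀ i, 0 < u i) (huM : u ᵥ* M = u) (hle : M *ᵥ v ≤ v) :
    M *ᵥ v = v :=
  eq_of_le_of_dotProduct_eq hu hle (by rw [dotProduct_mulVec, huM])

lemma abs_le_abs_vecMul {w : ι → R} (hM : ∀ i j, 0 ≤ M i j) (hw : w ᵥ* M = w) :
    |w| ≤ |w| ᵥ* M := fun j =>
  calc |w j| = |∑ i, w i * M i j| := congrArg abs (congrFun hw j).symm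
    _ ≤ ∑ i, |w i * M i j| := Finset.abs_sum_le_sum_abs _ _
    _ = ∑ i, |w i| * M i j :=
      Finset.sum_congr rfl fun i _ => by rw [abs_mul, abs_of_nonneg (hM i j)]

variable [DecidableEq ι]

lemma IrreducibleMatrix.exists_pos_vecMul_eq (hirr : IrreducibleMatrix M) (hM : ∀ i j, 0 ≤ M i j)
    (hdet : (1 - M).det = 0) (hv : ∀ i, 0 < v i) (hle : M *ᵥ v ≤ v) :
    ∃ u : ι → R, (∀ i, 0 < u i) ∧ u ᵥ* M = u := by
  obtain ⟨w, hw0, hw⟩ := exists_vecMul_eq_zero_iff.2 hdet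
  rw [vecMul_sub, vecMul_one, sub_eq_zero] at hw
  have hfix : |w| ᵥ* M = |w| :=
    vecMul_eq_of_le hv hle (abs_nonneg w) (abs_le_abs_vecMul hM hw.symm)
  refine ⟨|w|, hirr.transpose.pos_of_mulVec_le (fun i j => hM j i) (abs_nonneg w) ?_ ?_, hfix⟩
  · simpa using hw0
  · rw [mulVec_transpose, hfix]

lemma IrreducibleMatrix.mulVec_eq_of_le (hirr : IrreducibleMatrix M) (hM : ∀ i j, 0 ≤ M i j)
    (hdet : (1 - M).det = 0) (hv : ∀ i, 0 < v i) (hle : M *ᵥ v ≤ v) : M *ᵥ v = v := by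
  obtain ⟨u, hu, huM⟩ := hirr.exists_pos_vecMul_eq hM hdet hv hle
  exact CharSystem.mulVec_eq_of_le hu huM hle

end PerronFrobenius

section Solutions

open Matrix

variable {m : ℕ} {G : System m} {a : ℝ} {b τ : Fin m → ℝ} {J : Matrix (Fin m) (Fin m) ℝ}

/-- `(a, b)` is a real solution of the system `y = G(x, y)`: each `G i` converges at `(a, b)`, with
value `b i`. -/
def IsSolution (G : System m) (a : ℝ) (b : Fin m → ℝ) : Prop :=
  ∀ i, HasValue (G i) (Fin.cons a b : Fin (m + 1) → ℝ) (b i)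

lemma IsStandardSolution.hasSubst {T : Fin m → PowerSeries ℝ} (hT : IsStandardSolution G T) :
    MvPowerSeries.HasSubst (Fin.cons PowerSeries.X T : Fin (m + 1) → PowerSeries ℝ) :=
  MvPowerSeries.hasSubst_of_constantCoeff_zero <|
    Fin.cases PowerSeries.constantCoeff_X hT.constantCoeff

lemma IsStandardSolution.truncEvalLE {T : Fin m → PowerSeries ℝ} (hT : IsStandardSolution G T)
    (hG : ∀ i n, 0 ≤ MvPowerSeries.coeff n (G i)) (hG₀ : ∀ i, setZero {0} (G i) = 0)
    (ha : 0 ≤ a) (hb : ∀ i, 0 ≤ b i) (hsol : IsSolution G a b) (N : ℕ) (i : Fin m) :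
    TruncEvalLE a N (T i) (b i) := by
  induction N generalizing i with
  | zero => exact ⟨hT.nonneg i, by simpa using hb i⟩
  | succ N ih =>
    rw [hT.eq_subst i]
    refine TruncEvalLE.subst (hG i) hT.hasSubst ha (fun n hn => ?_) (hsol i)
    have hn₀ : n 0 ≠ 0 := fun h => hn (coeff_eq_zero_of_setZero_eq_zero (hG₀ i) (by simpa using h))
    exact .monomial_succ ha (Fin.cases (.X ha N) ih) rfl rfl hn₀

lemma IsExtremePoint.le_of_isSolution {ρ : ℝ} (hext : IsExtremePoint G ρ τ)
    (hG : ∀ i n, 0 ≤ MvPowerSeries.coeff n (G i)) (hG₀ : ∀ i, setZero {0} (G i) = 0)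
    (ha : 0 ≤ a) (hb : ∀ i, 0 ≤ b i) (hsol : IsSolution G a b) (i : Fin m) : a ≤ ρ := by
  obtain ⟨hρ, T, hT, hTρ⟩ := hext
  have h := ofReal_le_radius ha fun N => hT.truncEvalLE hG hG₀ ha hb hsol N i
  rwa [(hTρ i).1, ENNReal.ofReal_le_ofReal_iff hρ] at h

lemma IsExtremePoint.value_le_of_isSolution {ρ : ℝ} (hext : IsExtremePoint G ρ τ)
    (hG : ∀ i n, 0 ≤ MvPowerSeries.coeff n (G i)) (hG₀ : ∀ i, setZero {0} (G i) = 0)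
    (hb : ∀ i, 0 ≤ b i) (hsol : IsSolution G ρ b) (i : Fin m) : τ i ≤ b i := by
  obtain ⟨hρ, T, hT, hTρ⟩ := hext
  refine le_of_tendsto' (hTρ i).2.tendsto_sum_nat fun N => ?_
  rw [← eval_trunc_eq_sum]
  exact (hT.truncEvalLE hG hG₀ hρ hb hsol N i).eval_trunc_le

lemma irreducibleMatrix_of_hasValue {ι σ : Type*} {A : Matrix ι ι (MvPowerSeries σ ℝ)}
    (hirr : IrreducibleMatrix A) (hA : ∀ i j n, 0 ≤ MvPowerSeries.coeff n (A i j)) {c : σ → ℝ}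
    (hc : ∀ k, 0 < c k) {J : Matrix ι ι ℝ} (hJ : ∀ i j, HasValue (A i j) c (J i j)) :
    IrreducibleMatrix J := fun i j =>
  Relation.ReflTransGen.mono (fun k l hkl => ((hJ k l).pos (hA k l) hkl hc).ne') i j (hirr i j)

lemma sum_cons_mul_cons_sub_cons (D : Fin m → ℝ) :
    ∑ k, (Fin.cons 0 D : Fin (m + 1) → ℝ) k *
      ((Fin.cons a b : Fin (m + 1) → ℝ) k - (Fin.cons a τ : Fin (m + 1) → ℝ) k) =
      ∑ j, D j * (b j - τ j) := by
  simp [Fin.sum_univ_succ]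

lemma HasValue.pderiv_of_cons_ne {A : MvPowerSeries (Fin (m + 1)) ℝ} {D : Fin m → ℝ}
    (hD : ∀ j, HasValue (MvPowerSeries.pderiv ℝ (Fin.succ j) A)
      (Fin.cons a τ : Fin (m + 1) → ℝ) (D j)) (k : Fin (m + 1))
    (hk : (Fin.cons a τ : Fin (m + 1) → ℝ) k ≠ (Fin.cons a b : Fin (m + 1) → ℝ) k) :
    HasValue (MvPowerSeries.pderiv ℝ k A) (Fin.cons a τ : Fin (m + 1) → ℝ)
      ((Fin.cons 0 D : Fin (m + 1) → ℝ) k) := by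
  cases k using Fin.cases with
  | zero => exact absurd rfl hk
  | succ j => exact hD j

lemma IsSolution.jacobian_mulVec_sub_le (hτ : IsSolution G a τ) (hb : IsSolution G a b)
    (hG : ∀ i n, 0 ≤ MvPowerSeries.coeff n (G i)) (ha : 0 ≤ a) (hτ₀ : ∀ i, 0 ≤ τ i)
    (hle : ∀ i, τ i ≤ b i)
    (hJ : ∀ i j, HasValue (jacobian G i j) (Fin.cons a τ : Fin (m + 1) → ℝ) (J i j)) :
    J *ᵥ (b - τ) ≤ b - τ := fun i => by
  have h := (hτ i).add_sum_pderiv_le (hG i) (Fin.cases ha hτ₀) (Fin.cases le_rfl hle)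
    (HasValue.pderiv_of_cons_ne (hJ i)) (hb i)
  rw [sum_cons_mul_cons_sub_cons] at h
  exact le_sub_iff_add_le'.2 h

lemma IsSolution.jacobian_mulVec_sub_lt (hτ : IsSolution G a τ) (hb : IsSolution G a b)
    (hG : ∀ i n, 0 ≤ MvPowerSeries.coeff n (G i)) (ha : 0 < a) (hτ₀ : ∀ i, 0 ≤ τ i)
    (hlt : ∀ i, τ i < b i)
    (hJ : ∀ i j, HasValue (jacobian G i j) (Fin.cons a τ : Fin (m + 1) → ℝ) (J i j))
    {i j k : Fin m}
    (hijk : MvPowerSeries.pderiv ℝ j.succ (MvPowerSeries.pderiv ℝ k.succ (G i)) ≠ 0) :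
    (J *ᵥ (b - τ)) i < (b - τ) i := by
  have h := (hτ i).add_sum_pderiv_lt (hG i) (Fin.cases ha.le hτ₀)
    (Fin.cases le_rfl fun l => (hlt l).le) (Fin.cases ha fun l => (hτ₀ l).trans_lt (hlt l))
    (HasValue.pderiv_of_cons_ne (hJ i)) (hb i) (j := j.succ) (k := k.succ) (hlt j) (hlt k) hijk
  rw [sum_cons_mul_cons_sub_cons] at h
  exact lt_sub_iff_add_lt'.2 h

lemma IsCharacteristicPoint.eq_of_le (hτ : IsCharacteristicPoint G a τ)
    (hG : ∀ i n, 0 ≤ MvPowerSeries.coeff n (G i)) (hirr : IrreducibleMatrix (jacobian G))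
    (hnonlin : ∃ i j k : Fin m,
      MvPowerSeries.pderiv ℝ j.succ (MvPowerSeries.pderiv ℝ k.succ (G i)) ≠ 0)
    (hle : ∀ i, τ i ≤ b i) (hb : IsSolution G a b) : b = τ := by
  obtain ⟨ha, hτ₀, hτsol, J, hJ, hdet⟩ := hτ
  have hτ₀' : ∀ i, 0 ≤ τ i := fun i => (hτ₀ i).le
  have hJG : ∀ i j n, 0 ≤ MvPowerSeries.coeff n (jacobian G i j) := fun i j =>
    coeff_pderiv_nonneg (hG i) j.succ
  have hJ₀ : ∀ i j, 0 ≤ J i j := fun i j =>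
    (hJ i j).nonneg (hJG i j) (Fin.cases ha.le hτ₀')
  have hJirr : IrreducibleMatrix J :=
    irreducibleMatrix_of_hasValue hirr hJG (Fin.cases ha hτ₀) hJ
  have hsub : J *ᵥ (b - τ) ≤ b - τ :=
    IsSolution.jacobian_mulVec_sub_le hτsol hb hG ha.le hτ₀' hle hJ
  by_contra hne
  have hpos : ∀ i, 0 < (b - τ) i :=
    hJirr.pos_of_mulVec_le hJ₀ (sub_nonneg.2 hle) (sub_ne_zero.2 hne) hsub
  have hfix : J *ᵥ (b - τ) = b - τ := hJirr.mulVec_eq_of_le hJ₀ hdet hpos hsub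
  obtain ⟨i, j, k, hijk⟩ := hnonlin
  exact (IsSolution.jacobian_mulVec_sub_lt hτsol hb hG ha hτ₀' (fun l => sub_pos.1 (hpos l)) hJ
    hijk).ne (congrFun hfix i)

end Solutions

end CharSystem

theorem mainTheorem3_general {m : ℕ} (G : CharSystem.System m)
    (hG : ∀ i n, 0 ≤ MvPowerSeries.coeff n (G i))
    (hG₀ : ∀ i, CharSystem.setZero {0} (G i) = 0)
    (hirr : CharSystem.IrreducibleMatrix (CharSystem.jacobian G))
    (hnonlin : ∃ i j k : Fin m,
      MvPowerSeries.pderiv ℝ j.succ (MvPowerSeries.pderiv ℝ k.succ (G i)) ≠ 0)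
    (ρ : ℝ) (τ : Fin m → ℝ) (hext : CharSystem.IsExtremePoint G ρ τ)
    (hchar : CharSystem.IsCharacteristicPoint G ρ τ) :
    (∀ a b, 0 ≤ a → (∀ i, 0 ≤ b i) → CharSystem.IsSolution G a b → a ≤ ρ) ∧
      ∀ b, (∀ i, 0 ≤ b i) → CharSystem.IsSolution G ρ b → b = τ := by
  refine ⟨fun a b ha hb hsol => ?_, fun b hb hsol => ?_⟩
  · exact hext.le_of_isSolution hG hG₀ ha hb hsol hnonlin.choose
  · exact hchar.eq_of_le hG hirr hnonlin (hext.value_le_of_isSolution hG hG₀ hb hsol) hsol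

theorem mainTheorem3 {m : ℕ} (G : CharSystem.System m) (hG : CharSystem.WellConditioned G)
    (ρ : ℝ) (τ : Fin m → ℝ) (hext : CharSystem.IsExtremePoint G ρ τ)
    (hchar : CharSystem.IsCharacteristicPoint G ρ τ) :
    IsGreatest {a : ℝ | ∃ b : Fin m → ℝ, CharSystem.IsCharacteristicPoint G a b} ρ ∧
      ∀ b : Fin m → ℝ, CharSystem.IsCharacteristicPoint G ρ b → b = τ := by
  obtain ⟨hmax, huniq⟩ := mainTheorem3_general G hG.nonneg hG.x_zero hG.irreducible hG.nonlinear
    ρ τ hext hchar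
  exact ⟨⟨⟨τ, hchar⟩, fun a ⟨b, ha, hb, hsol, _⟩ => hmax a b ha.le (fun i => (hb i).le) hsol⟩,
    fun b ⟨_, hb, hsol, _⟩ => huniq b (fun i => (hb i).le) hsol⟩
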